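/- **Formulae and sequents.** Formulae are built from variables (primitive types) and the constant $\mathbf 1$ using the binary connectives $\backslash,\ /,\ \cdot,\ \vee,\ \wedge$ and the unary connectives $\langle\rangle,\ []^{-1},\ !$. A *stoup* is a finite multiset of formulae (possibly empty, $\varnothing$). A *tree term* is a formula or a bracketed expression $[\Xi]$, where $\Xi$ is a meta-formula. A *meta-formula* is an expression $\zeta;\Gamma$, where $\zeta$ is a stoup and $\Gamma$ is a finite sequence of tree terms (possibly empty, $\Lambda$). Commas denote multiset union of stoups and concatenation of sequences; an empty stoup is omitted. A *sequent* is $\Xi\to A$ with $\Xi$ a meta-formula and $A$ a formula. $\Xi(\zeta;\Gamma)$ denotes a meta-formula with a designated occurrence of the sub-meta-formula $\zeta;\Gamma$, which is either the whole meta-formula or the content of one of its brackets at any depth; replacing this occurrence by $\zeta';\Gamma'$ gives $\Xi(\zeta';\Gamma')$. **The system $!_{\mathbf b}^{\mathbf{2015}}\mathbf{MALC^*b}(\mathrm{st})'$.** Its axioms are $A\to A$ and $\Lambda\to\mathbf 1$, and its rules are the following (premises $\Longrightarrow$ conclusion); there is no cut rule. - $/L$: $\ \zeta_1;\Gamma\to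 B$ and $\Xi(\zeta_2;\Delta_1,C,\Delta_2)\to D\ \Longrightarrow\ \Xi(\zeta_1,\zeta_2;\Delta_1,C/B,\Gamma,\Delta_2)\to D$; - $/R$: $\ \zeta;\Gamma,B\to C\ \Longrightarrow\ \zeta;\Gamma\to C/B$; - $\backslash L$: $\ \zeta_1;\Gamma\to A$ and $\Xi(\zeta_2;\Delta_1,C,\Delta_2)\to D\ \Longrightarrow\ \Xi(\zeta_1,\zeta_2;\Delta_1,\Gamma,A\backslash C,\Delta_2)\to D$; - $\backslash R$: $\ \zeta;A,\Gamma\to C\ \Longrightarrow\ \zeta;\Gamma\to A\backslash C$; - $\cdot L$: $\ \Xi(\zeta;\Delta_1,A,B,\Delta_2)\to D\ \Longrightarrow\ \Xi(\zeta;\Delta_1,A\cdot B,\Delta_2)\to D$; - $\cdot R$: $\ \zeta_1;\Delta\to A$ and $\zeta_2;\Gamma\to B\ \Longrightarrow\ \zeta_1,\zeta_2;\Delta,\Gamma\to A\cdot B$; - $\mathbf 1L$: $\ \Xi(\zeta;\Delta_1,\Delta_2)\to A\ \Longrightarrow\ \Xi(\zeta;\Delta_1,\mathbf 1,\Delta_2)\to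 A$; - $\vee L$: $\ \Xi(\zeta;\Delta_1,A_1,\Delta_2)\to C$ and $\Xi(\zeta;\Delta_1,A_2,\Delta_2)\to C\ \Longrightarrow\ \Xi(\zeta;\Delta_1,A_1\vee A_2,\Delta_2)\to C$; - $\vee R_i$ ($i=1,2$): $\ \Xi\to A_i\ \Longrightarrow\ \Xi\to A_1\vee A_2$; - $\wedge L_j$ ($j=1,2$): $\ \Xi(\zeta;\Delta_1,A_j,\Delta_2)\to C\ \Longrightarrow\ \Xi(\zeta;\Delta_1,A_1\wedge A_2,\Delta_2)\to C$; - $\wedge R$: $\ \Xi\to A_1$ and $\Xi\to A_2\ \Longrightarrow\ \Xi\to A_1\wedge A_2$; - $[]^{-1}L$: $\ \Xi(\zeta;\Delta_1,A,\Delta_2)\to B\ \Longrightarrow\ \Xi(\zeta;\Delta_1,[\,[]^{-1}A\,],\Delta_2)\to B$; - $[]^{-1}R$: $\ [\Xi]\to A\ \Longrightarrow\ \Xi\to[]^{-1}A$; - $\langle\rangle L$: $\ \Xi(\zeta;\Delta_1,[A],\Delta_2)\to B\ \Longrightarrow\ \Xi(\zeta;\Delta_1,\langle\rangle A,\Delta_2)\to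 B$; - $\langle\rangle R$: $\ \Xi\to A\ \Longrightarrow\ [\Xi]\to\langle\rangle A$; - $!L$: $\ \Xi(\zeta,A;\Gamma_1,\Gamma_2)\to B\ \Longrightarrow\ \Xi(\zeta;\Gamma_1,!A,\Gamma_2)\to B$; - $!P$: $\ \Xi(\zeta;\Gamma_1,A,\Gamma_2)\to B\ \Longrightarrow\ \Xi(\zeta,A;\Gamma_1,\Gamma_2)\to B$; - $!R'$, provided $\zeta\ne\varnothing$: $\ \zeta;\Lambda\to B\ \Longrightarrow\ \zeta;\Lambda\to{!}B$; - $!C'$, provided $\zeta_2\ne\varnothing$: $\ \Xi(\zeta_1,\zeta_2;\Gamma_1,[\zeta',\zeta_2;\Gamma_2],\Gamma_3)\to C\ \Longrightarrow\ \Xi(\zeta_1,\zeta_2,\zeta';\Gamma_1,\Gamma_2,\Gamma_3)\to C$. **Theorem (cut admissibility).** Let the sequents $\xi;\Pi\to A$ and $\Xi(\zeta;\Gamma_1,A,\Gamma_2)\to C$ be derivable in $!_{\mathbf b}^{\mathbf{2015}}\mathbf{MALC^*b}(\mathrm{st})'$. Then the sequent $\Xi(\xi,\zeta;\Gamma_1,\Pi,\Gamma_2)\to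 C$ is also derivable in $!_{\mathbf b}^{\mathbf{2015}}\mathbf{MALC^*b}(\mathrm{st})'$. -/

import Mathlib

namespace Morrill

/-- Formulae over a set `V` of variables (primitive types). -/
inductive Formula (V : Type*) where
  | var (p : V) : Formula V
  | one : Formula V
  /-- Left division `A \ C`. -/
  | ldiv (A C : Formula V) : Formula V
  /-- Right division `C / B`. -/
  | rdiv (C B : Formula V) : Formula V
  /-- Product `A · B`. -/
  | prod (A B : Formula V) : Formula V
  /-- Additive disjunction `A ∨ B`. -/
  | or (A B : Formula V) : Formula V
  /-- Additive conjunction `A ∧ B`. -/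
  | and (A B : Formula V) : Formula V
  /-- Bracket modality `⟨⟩A`. -/
  | dia (A : Formula V) : Formula V
  /-- Bracket modality `[]⁻¹A`. -/
  | box (A : Formula V) : Formula V
  /-- Subexponential `!A`. -/
  | bang (A : Formula V) : Formula V

/-- A stoup is a finite multiset of formulae. -/
abbrev Stoup (V : Type*) := Multiset (Formula V)

/-- A tree term is a formula or a bracketed meta-formula `[ζ; Γ]`. -/
inductive TreeTerm (V : Type*) where
  | formula (A : Formula V) : TreeTerm V
  | bracket (ζ : Stoup V) (Γ : List (TreeTerm V)) : TreeTerm V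

/-- A meta-formula `ζ; Γ`: a stoup and a finite sequence of tree terms. -/
@[ext]
structure MetaFormula (V : Type*) where
  stoup : Stoup V
  seq : List (TreeTerm V)

/-- Formulae are tree terms. -/
instance (V : Type*) : Coe (Formula V) (TreeTerm V) := ⟨TreeTerm.formula⟩

/-- The bracketed tree term `[Ξ]`. -/
def MetaFormula.bracketed {V : Type*} (Ξ : MetaFormula V) : TreeTerm V :=
  TreeTerm.bracket Ξ.stoup Ξ.seq

/-- A meta-formula `Ξ( )` with one designated place for a sub-meta-formula: the place is either
the whole meta-formula, or it lies in the meta-formula inside one of the brackets. -/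
inductive MetaContext (V : Type*) where
  | hole : MetaContext V
  /-- The context `σ; Δ₁, [Ξ( )], Δ₂`. -/
  | inBracket (σ : Stoup V) (Δ₁ : List (TreeTerm V)) (Ξ : MetaContext V)
      (Δ₂ : List (TreeTerm V)) : MetaContext V

/-- `Ξ.fill Θ` is `Ξ(Θ)`. -/
def MetaContext.fill {V : Type*} : MetaContext V → MetaFormula V → MetaFormula V
  | .hole, Θ => Θ
  | .inBracket σ Δ₁ Ξ Δ₂, Θ => ⟨σ, Δ₁ ++ [(Ξ.fill Θ).bracketed] ++ Δ₂⟩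

open Formula in
/-- `Derivable Ξ C`: the sequent `Ξ → C` is derivable, without cut, in the modified 2015 system.
The calculus is the multiplicative-additive Lambek calculus with brackets and stoups
together with the rules `!L`, `!P`, `!R'` and `!C'`. -/
inductive Derivable {V : Type*} : MetaFormula V → Formula V → Prop
  | id (A : Formula V) : Derivable ⟨0, [(A : TreeTerm V)]⟩ A
  | rdivL (Ξ : MetaContext V) (ζ₁ ζ₂ : Stoup V) (Δ₁ Γ Δ₂ : List (TreeTerm V))
      (B C D : Formula V) :
      Derivable ⟨ζ₁, Γ⟩ B →
      Derivable (Ξ.fill ⟨ζ₂, Δ₁ ++ [(C : TreeTerm V)] ++ Δ₂⟩) D →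
      Derivable (Ξ.fill ⟨ζ₁ + ζ₂, Δ₁ ++ [(rdiv C B : TreeTerm V)] ++ Γ ++ Δ₂⟩) D
  | rdivR (ζ : Stoup V) (Γ : List (TreeTerm V)) (B C : Formula V) :
      Derivable ⟨ζ, Γ ++ [(B : TreeTerm V)]⟩ C →
      Derivable ⟨ζ, Γ⟩ (rdiv C B)
  | ldivL (Ξ : MetaContext V) (ζ₁ ζ₂ : Stoup V) (Δ₁ Γ Δ₂ : List (TreeTerm V))
      (A C D : Formula V) :
      Derivable ⟨ζ₁, Γ⟩ A →
      Derivable (Ξ.fill ⟨ζ₂, Δ₁ ++ [(C : TreeTerm V)] ++ Δ₂⟩) D →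
      Derivable (Ξ.fill ⟨ζ₁ + ζ₂, Δ₁ ++ Γ ++ [(ldiv A C : TreeTerm V)] ++ Δ₂⟩) D
  | ldivR (ζ : Stoup V) (Γ : List (TreeTerm V)) (A C : Formula V) :
      Derivable ⟨ζ, [(A : TreeTerm V)] ++ Γ⟩ C →
      Derivable ⟨ζ, Γ⟩ (ldiv A C)
  | prodL (Ξ : MetaContext V) (ζ : Stoup V) (Δ₁ Δ₂ : List (TreeTerm V)) (A B D : Formula V) :
      Derivable (Ξ.fill ⟨ζ, Δ₁ ++ [(A : TreeTerm V), (B : TreeTerm V)] ++ Δ₂⟩) D →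
      Derivable (Ξ.fill ⟨ζ, Δ₁ ++ [(prod A B : TreeTerm V)] ++ Δ₂⟩) D
  | prodR (ζ₁ ζ₂ : Stoup V) (Δ Γ : List (TreeTerm V)) (A B : Formula V) :
      Derivable ⟨ζ₁, Δ⟩ A →
      Derivable ⟨ζ₂, Γ⟩ B →
      Derivable ⟨ζ₁ + ζ₂, Δ ++ Γ⟩ (prod A B)
  | oneL (Ξ : MetaContext V) (ζ : Stoup V) (Δ₁ Δ₂ : List (TreeTerm V)) (A : Formula V) :
      Derivable (Ξ.fill ⟨ζ, Δ₁ ++ Δ₂⟩) A →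
      Derivable (Ξ.fill ⟨ζ, Δ₁ ++ [((one : Formula V) : TreeTerm V)] ++ Δ₂⟩) A
  | oneR : Derivable ⟨0, []⟩ one
  | orL (Ξ : MetaContext V) (ζ : Stoup V) (Δ₁ Δ₂ : List (TreeTerm V)) (A₁ A₂ C : Formula V) :
      Derivable (Ξ.fill ⟨ζ, Δ₁ ++ [(A₁ : TreeTerm V)] ++ Δ₂⟩) C →
      Derivable (Ξ.fill ⟨ζ, Δ₁ ++ [(A₂ : TreeTerm V)] ++ Δ₂⟩) C →
      Derivable (Ξ.fill ⟨ζ, Δ₁ ++ [(or A₁ A₂ : TreeTerm V)] ++ Δ₂⟩) C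
  | orR₁ (Ξ : MetaFormula V) (A₁ A₂ : Formula V) :
      Derivable Ξ A₁ → Derivable Ξ (or A₁ A₂)
  | orR₂ (Ξ : MetaFormula V) (A₁ A₂ : Formula V) :
      Derivable Ξ A₂ → Derivable Ξ (or A₁ A₂)
  | andL₁ (Ξ : MetaContext V) (ζ : Stoup V) (Δ₁ Δ₂ : List (TreeTerm V))
      (A₁ A₂ C : Formula V) :
      Derivable (Ξ.fill ⟨ζ, Δ₁ ++ [(A₁ : TreeTerm V)] ++ Δ₂⟩) C →
      Derivable (Ξ.fill ⟨ζ, Δ₁ ++ [(and A₁ A₂ : TreeTerm V)] ++ Δ₂⟩) C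
  | andL₂ (Ξ : MetaContext V) (ζ : Stoup V) (Δ₁ Δ₂ : List (TreeTerm V))
      (A₁ A₂ C : Formula V) :
      Derivable (Ξ.fill ⟨ζ, Δ₁ ++ [(A₂ : TreeTerm V)] ++ Δ₂⟩) C →
      Derivable (Ξ.fill ⟨ζ, Δ₁ ++ [(and A₁ A₂ : TreeTerm V)] ++ Δ₂⟩) C
  | andR (Ξ : MetaFormula V) (A₁ A₂ : Formula V) :
      Derivable Ξ A₁ → Derivable Ξ A₂ → Derivable Ξ (and A₁ A₂)
  | boxL (Ξ : MetaContext V) (ζ : Stoup V) (Δ₁ Δ₂ : List (TreeTerm V)) (A B : Formula V) :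
      Derivable (Ξ.fill ⟨ζ, Δ₁ ++ [(A : TreeTerm V)] ++ Δ₂⟩) B →
      Derivable (Ξ.fill ⟨ζ, Δ₁ ++ [TreeTerm.bracket 0 [(box A : TreeTerm V)]] ++ Δ₂⟩) B
  | boxR (Ξ : MetaFormula V) (A : Formula V) :
      Derivable ⟨0, [Ξ.bracketed]⟩ A →
      Derivable Ξ (box A)
  | diaL (Ξ : MetaContext V) (ζ : Stoup V) (Δ₁ Δ₂ : List (TreeTerm V)) (A B : Formula V) :
      Derivable (Ξ.fill ⟨ζ, Δ₁ ++ [TreeTerm.bracket 0 [(A : TreeTerm V)]] ++ Δ₂⟩) B →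
      Derivable (Ξ.fill ⟨ζ, Δ₁ ++ [(dia A : TreeTerm V)] ++ Δ₂⟩) B
  | diaR (Ξ : MetaFormula V) (A : Formula V) :
      Derivable Ξ A →
      Derivable ⟨0, [Ξ.bracketed]⟩ (dia A)
  | bangL (Ξ : MetaContext V) (ζ : Stoup V) (Γ₁ Γ₂ : List (TreeTerm V)) (A B : Formula V) :
      Derivable (Ξ.fill ⟨ζ + {A}, Γ₁ ++ Γ₂⟩) B →
      Derivable (Ξ.fill ⟨ζ, Γ₁ ++ [(bang A : TreeTerm V)] ++ Γ₂⟩) B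
  | bangP (Ξ : MetaContext V) (ζ : Stoup V) (Γ₁ Γ₂ : List (TreeTerm V)) (A B : Formula V) :
      Derivable (Ξ.fill ⟨ζ, Γ₁ ++ [(A : TreeTerm V)] ++ Γ₂⟩) B →
      Derivable (Ξ.fill ⟨ζ + {A}, Γ₁ ++ Γ₂⟩) B
  | bangR (ζ : Stoup V) (B : Formula V) :
      ζ ≠ 0 →
      Derivable ⟨ζ, []⟩ B →
      Derivable ⟨ζ, []⟩ (bang B)
  | bangC (Ξ : MetaContext V) (ζ₁ ζ₂ ζ' : Stoup V) (Γ₁ Γ₂ Γ₃ : List (TreeTerm V))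
      (C : Formula V) :
      ζ₂ ≠ 0 →
      Derivable (Ξ.fill ⟨ζ₁ + ζ₂, Γ₁ ++ [TreeTerm.bracket (ζ' + ζ₂) Γ₂] ++ Γ₃⟩) C →
      Derivable (Ξ.fill ⟨ζ₁ + ζ₂ + ζ', Γ₁ ++ Γ₂ ++ Γ₃⟩) C

end Morrill

/-! The proof is semantic, by an Okada-style phase model built from cut-free derivability, so no
induction on cuts is needed. Call a set of meta-formulae closed if it is an intersection of sets `{Θ
| Derivable (f Θ) C}`, where `f` is a context. Every formula is interpreted by a closed set:
conjunction is intersection, divisions are residuals, `[]⁻¹` is a preimage, and `1`, `·`, `∨`, `⟨⟩`,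
`!` are closures of the obvious generators.

Two facts carry the argument. `mem_interp_and_derivable`: `interp A` contains `A` itself, and all
its elements derive `A`. `Derivable.instance_mem_interp` (soundness): if `Φ → C` is derivable, then
replacing the formulae of `Φ` by elements of their interpretations gives an element of `interp C`.

For cut, soundness of the left premise puts `ξ; Π` in `interp A`. So the antecedent of the
conclusion is an instance of that of the right premise, every other formula standing for itself. By
soundness it lies in `interp C`, hence derives `C`.

A formula in a stoup may only be replaced by a stoup, since `!R'` and `!C'` act on stoups, and by a
nonempty one, since both rules have a nonemptiness condition. -/

namespace Morrill

variable {V : Type*}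

/-! ### The monoid of meta-formulae -/

namespace MetaFormula

/-- Meta-formulae form a monoid: stoups are added and sequences are concatenated. -/
instance : Monoid (MetaFormula V) where
  mul Θ Θ' := ⟨Θ.stoup + Θ'.stoup, Θ.seq ++ Θ'.seq⟩
  one := ⟨0, []⟩
  mul_assoc _ _ _ := MetaFormula.ext (add_assoc _ _ _) (List.append_assoc _ _ _)
  one_mul _ := MetaFormula.ext (zero_add _) (List.nil_append _)
  mul_one _ := MetaFormula.ext (add_zero _) (List.append_nil _)

theorem mul_def (Θ Θ' : MetaFormula V) :
    Θ * Θ' = ⟨Θ.stoup + Θ'.stoup, Θ.seq ++ Θ'.seq⟩ := rfl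

theorem one_def : (1 : MetaFormula V) = ⟨0, []⟩ := rfl

/-- The meta-formula with a given stoup and the empty sequence. -/
def ofStoup (ζ : Stoup V) : MetaFormula V := ⟨ζ, []⟩

/-- The meta-formula with empty stoup consisting of one tree term. -/
def ofTerm (t : TreeTerm V) : MetaFormula V := ⟨0, [t]⟩

theorem ofStoup_add (ζ ζ' : Stoup V) : ofStoup (ζ + ζ') = ofStoup ζ * ofStoup ζ' := rfl

theorem ofStoup_mul_comm (ζ : Stoup V) (Θ : MetaFormula V) :
    ofStoup ζ * Θ = Θ * ofStoup ζ := by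
  simp [mul_def, ofStoup, add_comm]

theorem ofStoup_mul_left_comm (ζ : Stoup V) (Θ Θ' : MetaFormula V) :
    ofStoup ζ * (Θ * Θ') = Θ * (ofStoup ζ * Θ') := by
  rw [← mul_assoc, ofStoup_mul_comm, mul_assoc]

end MetaFormula

open MetaFormula

/-! ### Contexts -/

/-- Composition of contexts. -/
def MetaContext.comp : MetaContext V → MetaContext V → MetaContext V
  | .hole, Ξ' => Ξ'
  | .inBracket σ Δ₁ Ξ Δ₂, Ξ' => .inBracket σ Δ₁ (Ξ.comp Ξ') Δ₂

theorem MetaContext.fill_comp (Ξ Ξ' : MetaContext V) (Θ : MetaFormula V) :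
    (Ξ.comp Ξ').fill Θ = Ξ.fill (Ξ'.fill Θ) := by
  induction Ξ with
  | hole => rfl
  | inBracket σ Δ₁ Ξ Δ₂ ih => simp only [MetaContext.comp, MetaContext.fill, ih]

/-- Maps of the form `Θ ↦ Ξ(Θ₁, Θ, Θ₂)`. -/
def IsContext (f : MetaFormula V → MetaFormula V) : Prop :=
  ∃ (Ξ : MetaContext V) (Θ₁ Θ₂ : MetaFormula V), ∀ Θ, f Θ = Ξ.fill (Θ₁ * Θ * Θ₂)

theorem isContext_fill (Ξ : MetaContext V) : IsContext Ξ.fill :=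
  ⟨Ξ, 1, 1, fun Θ => by simp⟩

theorem isContext_id : IsContext (fun Θ : MetaFormula V => Θ) :=
  isContext_fill .hole

theorem isContext_mul (Θ₁ Θ₂ : MetaFormula V) : IsContext (fun Θ => Θ₁ * Θ * Θ₂) :=
  ⟨.hole, Θ₁, Θ₂, fun _ => rfl⟩

theorem isContext_bracket : IsContext (fun Θ : MetaFormula V => ofTerm Θ.bracketed) :=
  ⟨.inBracket 0 [] .hole [], 1, 1, fun Θ => by simp [MetaContext.fill, ofTerm]⟩

/-- If the inner place is at top level, the side factors multiply; otherwise the outer ones are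
absorbed into the stoup and sequence around the outermost inner bracket. -/
theorem IsContext.comp {f g : MetaFormula V → MetaFormula V} (hf : IsContext f)
    (hg : IsContext g) : IsContext (fun Θ => f (g Θ)) := by
  obtain ⟨Ξ, Θ₁, Θ₂, hf⟩ := hf
  obtain ⟨Ξ', Θ₁', Θ₂', hg⟩ := hg
  cases Ξ' with
  | hole => exact ⟨Ξ, Θ₁ * Θ₁', Θ₂' * Θ₂, fun Θ => by simp [hf, hg, MetaContext.fill, mul_assoc]⟩
  | inBracket σ Δ₁ Ξ' Δ₂ =>
    exact ⟨Ξ.comp (.inBracket (Θ₁.stoup + σ + Θ₂.stoup) (Θ₁.seq ++ Δ₁) Ξ' (Δ₂ ++ Θ₂.seq)),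
      Θ₁', Θ₂', fun Θ => by
        simp [hf, hg, MetaContext.fill_comp, MetaContext.fill, MetaFormula.mul_def]⟩

/-! ### Closed sets -/

/-- The closure of a set of meta-formulae: all meta-formulae that may stand in every derivable
sequent in which the elements of the set may stand. -/
def derivClosure (S : Set (MetaFormula V)) : Set (MetaFormula V) :=
  {Θ | ∀ f, IsContext f → ∀ C, (∀ Θ' ∈ S, Derivable (f Θ') C) → Derivable (f Θ) C}

/-- A set of meta-formulae is closed if it equals its closure. -/
def IsDerivClosed (S : Set (MetaFormula V)) : Prop := derivClosure S ⊆ S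

theorem subset_derivClosure (S : Set (MetaFormula V)) : S ⊆ derivClosure S :=
  fun Θ hΘ _ _ _ h => h Θ hΘ

/-- A context which maps a set into a closed set maps its closure into that closed set. -/
theorem IsDerivClosed.map_mem {U S : Set (MetaFormula V)} (hU : IsDerivClosed U)
    {g : MetaFormula V → MetaFormula V} (hg : IsContext g) (h : ∀ Θ ∈ S, g Θ ∈ U)
    {Θ : MetaFormula V} (hΘ : Θ ∈ derivClosure S) : g Θ ∈ U :=
  hU fun f hf C hC => hΘ (fun Θ => f (g Θ)) (hf.comp hg) C fun Θ' hΘ' => hC _ (h Θ' hΘ')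

theorem isDerivClosed_derivClosure (S : Set (MetaFormula V)) : IsDerivClosed (derivClosure S) :=
  fun _ hΘ f hf C hC => hΘ f hf C fun _ hΘ' => hΘ' f hf C hC

theorem IsDerivClosed.preimage {U : Set (MetaFormula V)} (hU : IsDerivClosed U)
    {g : MetaFormula V → MetaFormula V} (hg : IsContext g) : IsDerivClosed {Θ | g Θ ∈ U} :=
  fun _ hΘ => hU.map_mem hg (fun _ h => h) hΘ

theorem IsDerivClosed.inter {U W : Set (MetaFormula V)} (hU : IsDerivClosed U)
    (hW : IsDerivClosed W) : IsDerivClosed (U ∩ W) :=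
  fun _ hΘ => ⟨hU.map_mem isContext_id (fun _ h => h.1) hΘ,
    hW.map_mem isContext_id (fun _ h => h.2) hΘ⟩

theorem isDerivClosed_derivable (A : Formula V) : IsDerivClosed {Θ | Derivable Θ A} :=
  fun _ hΘ => hΘ _ isContext_id A fun _ h => h

/-! ### Left and structural rules as replacements -/

/-- `Θ` may replace `Θ'` in every derivable sequent. -/
def Replaces (Θ Θ' : MetaFormula V) : Prop :=
  ∀ f, IsContext f → ∀ C, Derivable (f Θ') C → Derivable (f Θ) C

/-- Replaceability puts `f Θ` in the closure of the singleton `{f Θ'}`. This is how a rule of the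
calculus becomes a property of closed sets. -/
theorem IsDerivClosed.mem_of_replaces {U : Set (MetaFormula V)} (hU : IsDerivClosed U)
    {f : MetaFormula V → MetaFormula V} (hf : IsContext f)
    {Θ Θ' : MetaFormula V} (h : Replaces Θ Θ') (h' : f Θ' ∈ U) : f Θ ∈ U :=
  hU fun g hg C hC => h (fun Θ => g (f Θ)) (hg.comp hf) C (hC _ h')

theorem replaces_rdiv (B C : Formula V) {Θ : MetaFormula V} (h : Derivable Θ B) :
    Replaces (ofTerm (Formula.rdiv C B) * Θ) (ofTerm C) := by
  rintro f ⟨Ξ, Θ₁, Θ₂, hf⟩ D hD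
  rw [hf] at hD ⊢
  have := Derivable.rdivL Ξ Θ.stoup (Θ₁.stoup + Θ₂.stoup) Θ₁.seq Θ.seq Θ₂.seq B C D h
    (by simpa [MetaFormula.mul_def, ofTerm] using hD)
  simpa [MetaFormula.mul_def, ofTerm, add_assoc, add_left_comm] using this

theorem replaces_ldiv (A C : Formula V) {Θ : MetaFormula V} (h : Derivable Θ A) :
    Replaces (Θ * ofTerm (Formula.ldiv A C)) (ofTerm C) := by
  rintro f ⟨Ξ, Θ₁, Θ₂, hf⟩ D hD
  rw [hf] at hD ⊢
  have := Derivable.ldivL Ξ Θ.stoup (Θ₁.stoup + Θ₂.stoup) Θ₁.seq Θ.seq Θ₂.seq A C D h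
    (by simpa [MetaFormula.mul_def, ofTerm] using hD)
  simpa [MetaFormula.mul_def, ofTerm, add_assoc, add_left_comm] using this

theorem replaces_prod (A B : Formula V) :
    Replaces (ofTerm (Formula.prod A B)) (ofTerm (A : TreeTerm V) * ofTerm (B : TreeTerm V)) := by
  rintro f ⟨Ξ, Θ₁, Θ₂, hf⟩ D hD
  rw [hf] at hD ⊢
  have := Derivable.prodL Ξ (Θ₁.stoup + Θ₂.stoup) Θ₁.seq Θ₂.seq A B D
    (by simpa [MetaFormula.mul_def, ofTerm] using hD)
  simpa [MetaFormula.mul_def, ofTerm] using this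

theorem replaces_one : Replaces (ofTerm ((Formula.one : Formula V) : TreeTerm V)) 1 := by
  rintro f ⟨Ξ, Θ₁, Θ₂, hf⟩ D hD
  rw [hf] at hD ⊢
  have := Derivable.oneL Ξ (Θ₁.stoup + Θ₂.stoup) Θ₁.seq Θ₂.seq D
    (by simpa [MetaFormula.mul_def] using hD)
  simpa [MetaFormula.mul_def, ofTerm] using this

theorem replaces_and_left (A B : Formula V) :
    Replaces (ofTerm (Formula.and A B)) (ofTerm (A : TreeTerm V)) := by
  rintro f ⟨Ξ, Θ₁, Θ₂, hf⟩ D hD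
  rw [hf] at hD ⊢
  have := Derivable.andL₁ Ξ (Θ₁.stoup + Θ₂.stoup) Θ₁.seq Θ₂.seq A B D
    (by simpa [MetaFormula.mul_def, ofTerm] using hD)
  simpa [MetaFormula.mul_def, ofTerm] using this

theorem replaces_and_right (A B : Formula V) :
    Replaces (ofTerm (Formula.and A B)) (ofTerm (B : TreeTerm V)) := by
  rintro f ⟨Ξ, Θ₁, Θ₂, hf⟩ D hD
  rw [hf] at hD ⊢
  have := Derivable.andL₂ Ξ (Θ₁.stoup + Θ₂.stoup) Θ₁.seq Θ₂.seq A B D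
    (by simpa [MetaFormula.mul_def, ofTerm] using hD)
  simpa [MetaFormula.mul_def, ofTerm] using this

theorem replaces_box (A : Formula V) :
    Replaces (ofTerm (ofTerm (Formula.box A)).bracketed) (ofTerm (A : TreeTerm V)) := by
  rintro f ⟨Ξ, Θ₁, Θ₂, hf⟩ D hD
  rw [hf] at hD ⊢
  have := Derivable.boxL Ξ (Θ₁.stoup + Θ₂.stoup) Θ₁.seq Θ₂.seq A D
    (by simpa [MetaFormula.mul_def, ofTerm] using hD)
  simpa [MetaFormula.mul_def, ofTerm, bracketed] using this

theorem replaces_dia (A : Formula V) :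
    Replaces (ofTerm (Formula.dia A)) (ofTerm (ofTerm (A : TreeTerm V)).bracketed) := by
  rintro f ⟨Ξ, Θ₁, Θ₂, hf⟩ D hD
  rw [hf] at hD ⊢
  have := Derivable.diaL Ξ (Θ₁.stoup + Θ₂.stoup) Θ₁.seq Θ₂.seq A D
    (by simpa [MetaFormula.mul_def, ofTerm, bracketed] using hD)
  simpa [MetaFormula.mul_def, ofTerm] using this

theorem replaces_bang (A : Formula V) :
    Replaces (ofTerm (Formula.bang A)) (ofStoup {A}) := by
  rintro f ⟨Ξ, Θ₁, Θ₂, hf⟩ D hD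
  rw [hf] at hD ⊢
  have := Derivable.bangL Ξ (Θ₁.stoup + Θ₂.stoup) Θ₁.seq Θ₂.seq A D
    (by simpa [MetaFormula.mul_def, ofStoup, add_right_comm] using hD)
  simpa [MetaFormula.mul_def, ofTerm] using this

theorem replaces_stoup (A : Formula V) :
    Replaces (ofStoup {A}) (ofTerm (A : TreeTerm V)) := by
  rintro f ⟨Ξ, Θ₁, Θ₂, hf⟩ D hD
  rw [hf] at hD ⊢
  have := Derivable.bangP Ξ (Θ₁.stoup + Θ₂.stoup) Θ₁.seq Θ₂.seq A D
    (by simpa [MetaFormula.mul_def, ofTerm] using hD)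
  simpa [MetaFormula.mul_def, ofStoup, add_right_comm] using this

theorem replaces_contraction {ζ : Stoup V} (hζ : ζ ≠ 0) (Θ : MetaFormula V) :
    Replaces (ofStoup ζ * Θ) (ofStoup ζ * ofTerm (ofStoup ζ * Θ).bracketed) := by
  rintro f ⟨Ξ, Θ₁, Θ₂, hf⟩ D hD
  rw [hf] at hD ⊢
  have := Derivable.bangC Ξ (Θ₁.stoup + Θ₂.stoup) ζ Θ.stoup Θ₁.seq Θ.seq Θ₂.seq D hζ
    (by simpa [MetaFormula.mul_def, ofStoup, ofTerm, bracketed, add_right_comm,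
      add_comm Θ.stoup] using hD)
  simpa [MetaFormula.mul_def, ofStoup, ← add_assoc, add_right_comm] using this

/-! ### The phase model -/

/-- The interpretation of a formula as a closed set of meta-formulae. -/
def interp : Formula V → Set (MetaFormula V)
  | .var p => {Θ | Derivable Θ (.var p)}
  | .one => derivClosure {1}
  | .ldiv A C => {Θ | ∀ Θ' ∈ interp A, Θ' * Θ ∈ interp C}
  | .rdiv C B => {Θ | ∀ Θ' ∈ interp B, Θ * Θ' ∈ interp C}
  | .prod A B => derivClosure {Θ | ∃ Θ₁ ∈ interp A, ∃ Θ₂ ∈ interp B, Θ = Θ₁ * Θ₂}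
  | .or A B => derivClosure (interp A ∪ interp B)
  | .and A B => interp A ∩ interp B
  | .dia A => derivClosure {Θ | ∃ Θ' ∈ interp A, Θ = ofTerm Θ'.bracketed}
  | .box A => {Θ | ofTerm Θ.bracketed ∈ interp A}
  | .bang A => derivClosure {Θ | ∃ ξ : Stoup V, ξ ≠ 0 ∧ ofStoup ξ ∈ interp A ∧ Θ = ofStoup ξ}

theorem isDerivClosed_interp (A : Formula V) : IsDerivClosed (interp A) := by
  induction A with
  | var p => exact isDerivClosed_derivable _
  | one => exact isDerivClosed_derivClosure _
  | ldiv A C _ ihC =>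
    intro Θ hΘ Θ' hΘ'
    have := ihC.map_mem (isContext_mul Θ' 1) (fun Θ h => by simpa using h Θ' hΘ') hΘ
    simpa using this
  | rdiv C B ihC _ =>
    intro Θ hΘ Θ' hΘ'
    have := ihC.map_mem (isContext_mul 1 Θ') (fun Θ h => by simpa using h Θ' hΘ') hΘ
    simpa using this
  | prod A B => exact isDerivClosed_derivClosure _
  | or A B => exact isDerivClosed_derivClosure _
  | and A B ihA ihB => exact ihA.inter ihB
  | dia A => exact isDerivClosed_derivClosure _
  | box A ih => exact ih.preimage isContext_bracket
  | bang A => exact isDerivClosed_derivClosure _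

theorem ofStoup_singleton_mem_interp {A : Formula V} (h : ofTerm (A : TreeTerm V) ∈ interp A) :
    ofStoup {A} ∈ interp A :=
  (isDerivClosed_interp A).mem_of_replaces isContext_id (replaces_stoup A) h

/-- The interpretation of `A` contains `A` and consists of meta-formulae that derive `A`. -/
theorem mem_interp_and_derivable (A : Formula V) :
    ofTerm (A : TreeTerm V) ∈ interp A ∧ ∀ Θ ∈ interp A, Derivable Θ A := by
  induction A with
  | var p => exact ⟨Derivable.id _, fun _ h => h⟩
  | one =>
    refine ⟨fun f hf C h => replaces_one f hf C (h 1 rfl), fun Θ h => ?_⟩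
    refine (isDerivClosed_derivable _).map_mem isContext_id ?_ h
    rintro _ rfl
    exact Derivable.oneR
  | ldiv A C ihA ihC =>
    -- Each half of the claim for a division uses the opposite half for the denominator, so both are
    -- proved simultaneously.
    refine ⟨fun Θ h => ?_, fun Θ h => ?_⟩
    · exact (isDerivClosed_interp C).mem_of_replaces isContext_id
        (replaces_ldiv A C (ihA.2 Θ h)) ihC.1
    · have := ihC.2 _ (h _ ihA.1)
      exact Derivable.ldivR _ _ _ _ (by simpa [MetaFormula.mul_def, ofTerm] using this)
  | rdiv C B ihC ihB =>
    refine ⟨fun Θ h => ?_, fun Θ h => ?_⟩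
    · exact (isDerivClosed_interp C).mem_of_replaces isContext_id
        (replaces_rdiv B C (ihB.2 Θ h)) ihC.1
    · have := ihC.2 _ (h _ ihB.1)
      exact Derivable.rdivR _ _ _ _ (by simpa [MetaFormula.mul_def, ofTerm] using this)
  | prod A B ihA ihB =>
    refine ⟨fun f hf C h => replaces_prod A B f hf C (h _ ⟨_, ihA.1, _, ihB.1, rfl⟩),
      fun Θ h => (isDerivClosed_derivable _).map_mem isContext_id ?_ h⟩
    rintro _ ⟨Θ₁, h₁, Θ₂, h₂, rfl⟩
    exact Derivable.prodR _ _ _ _ _ _ (ihA.2 _ h₁) (ihB.2 _ h₂)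
  | or A B ihA ihB =>
    refine ⟨?_, fun Θ h => (isDerivClosed_derivable _).map_mem isContext_id ?_ h⟩
    -- `∨L` has two premises in the same context, so it is not a `Replaces` statement and is applied
    -- directly to both generators.
    · rintro f ⟨Ξ, Θ₁, Θ₂, hf⟩ C h
      have hA := h _ (Or.inl ihA.1)
      have hB := h _ (Or.inr ihB.1)
      rw [hf] at hA hB ⊢
      have := Derivable.orL Ξ (Θ₁.stoup + Θ₂.stoup) Θ₁.seq Θ₂.seq A B C
        (by simpa [MetaFormula.mul_def, ofTerm] using hA)
        (by simpa [MetaFormula.mul_def, ofTerm] using hB)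
      simpa [MetaFormula.mul_def, ofTerm] using this
    · rintro Θ (h | h)
      · exact Derivable.orR₁ _ _ _ (ihA.2 _ h)
      · exact Derivable.orR₂ _ _ _ (ihB.2 _ h)
  | and A B ihA ihB =>
    refine ⟨⟨?_, ?_⟩, fun Θ h => Derivable.andR _ _ _ (ihA.2 _ h.1) (ihB.2 _ h.2)⟩
    · exact (isDerivClosed_interp A).mem_of_replaces isContext_id (replaces_and_left A B) ihA.1
    · exact (isDerivClosed_interp B).mem_of_replaces isContext_id (replaces_and_right A B) ihB.1
  | dia A ih =>
    refine ⟨fun f hf C h => replaces_dia A f hf C (h _ ⟨_, ih.1, rfl⟩),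
      fun Θ h => (isDerivClosed_derivable _).map_mem isContext_id ?_ h⟩
    rintro _ ⟨Θ, h, rfl⟩
    exact Derivable.diaR _ _ (ih.2 _ h)
  | box A ih =>
    exact ⟨(isDerivClosed_interp A).mem_of_replaces isContext_id (replaces_box A) ih.1,
      fun Θ h => Derivable.boxR _ _ (ih.2 _ h)⟩
  | bang A ih =>
    refine ⟨fun f hf C h => replaces_bang A f hf C
        (h _ ⟨{A}, by simp, ofStoup_singleton_mem_interp ih.1, rfl⟩),
      fun Θ h => (isDerivClosed_derivable _).map_mem isContext_id ?_ h⟩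
    rintro _ ⟨ξ, hξ, h, rfl⟩
    exact Derivable.bangR _ _ hξ (ih.2 _ h)

/-! ### Instances of stoups and meta-formulae -/

/-- `σ` arises from the stoup `ζ` by replacing each formula by a nonempty stoup in its
interpretation. -/
def StoupInstance (ζ σ : Stoup V) : Prop :=
  ∃ T : Multiset (Stoup V),
    Multiset.Rel (fun A ξ => ξ ≠ 0 ∧ ofStoup ξ ∈ interp A) ζ T ∧ T.sum = σ

theorem stoupInstance_zero : StoupInstance (0 : Stoup V) 0 := ⟨0, Multiset.Rel.zero, rfl⟩

theorem stoupInstance_zero_iff {σ : Stoup V} : StoupInstance 0 σ ↔ σ = 0 := by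
  simp [StoupInstance, eq_comm]

theorem stoupInstance_singleton {A : Formula V} {ξ : Stoup V} (hξ : ξ ≠ 0)
    (h : ofStoup ξ ∈ interp A) : StoupInstance {A} ξ :=
  ⟨{ξ}, Multiset.rel_cons_left.2 ⟨ξ, 0, ⟨hξ, h⟩, Multiset.Rel.zero, rfl⟩, by simp⟩

theorem StoupInstance.of_singleton {A : Formula V} {σ : Stoup V} (h : StoupInstance {A} σ) :
    ofStoup σ ∈ interp A := by
  obtain ⟨T, hT, rfl⟩ := h
  obtain ⟨ξ, T', h, hT', rfl⟩ := Multiset.rel_cons_left.1 hT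
  simpa [Multiset.rel_zero_left.1 hT'] using h.2

theorem StoupInstance.add {ζ ζ' σ σ' : Stoup V} (h : StoupInstance ζ σ)
    (h' : StoupInstance ζ' σ') : StoupInstance (ζ + ζ') (σ + σ') := by
  obtain ⟨T, hT, rfl⟩ := h
  obtain ⟨T', hT', rfl⟩ := h'
  exact ⟨T + T', hT.add hT', by simp⟩

theorem StoupInstance.of_add {ζ ζ' σ : Stoup V} (h : StoupInstance (ζ + ζ') σ) :
    ∃ σ₁ σ₂, StoupInstance ζ σ₁ ∧ StoupInstance ζ' σ₂ ∧ σ = σ₁ + σ₂ := by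
  obtain ⟨T, hT, rfl⟩ := h
  obtain ⟨T₁, T₂, h₁, h₂, rfl⟩ := Multiset.rel_add_left.1 hT
  exact ⟨_, _, ⟨T₁, h₁, rfl⟩, ⟨T₂, h₂, rfl⟩, by simp⟩

/-- Transfers the side conditions of `!R'` and `!C'` to instances. -/
theorem StoupInstance.ne_zero {ζ σ : Stoup V} (h : StoupInstance ζ σ) (hζ : ζ ≠ 0) : σ ≠ 0 := by
  obtain ⟨T, hT, rfl⟩ := h
  obtain ⟨A, hA⟩ := Multiset.exists_mem_of_ne_zero hζ
  obtain ⟨ζ', rfl⟩ := Multiset.exists_cons_of_mem hA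
  obtain ⟨ξ, T', h, -, rfl⟩ := Multiset.rel_cons_left.1 hT
  simp [h.1]

theorem stoupInstance_self (ζ : Stoup V) : StoupInstance ζ ζ := by
  induction ζ using Multiset.induction_on with
  | empty => exact stoupInstance_zero
  | cons A ζ ih =>
    exact (stoupInstance_singleton (by simp)
      (ofStoup_singleton_mem_interp (mem_interp_and_derivable A).1)).add ih

/-- `Θ` arises from the sequence `Γ` by replacing each formula by an element of its
interpretation, and each formula in a stoup by a nonempty stoup in its interpretation. -/
inductive SeqInstance : List (TreeTerm V) → MetaFormula V → Prop
  | nil : SeqInstance [] 1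
  | formula (A : Formula V) (Γ : List (TreeTerm V)) (Θ Θ' : MetaFormula V) :
      Θ ∈ interp A → SeqInstance Γ Θ' → SeqInstance ((A : TreeTerm V) :: Γ) (Θ * Θ')
  | bracket (ζ σ : Stoup V) (Γ Δ : List (TreeTerm V)) (Θ Θ' : MetaFormula V) :
      StoupInstance ζ σ → SeqInstance Γ Θ → SeqInstance Δ Θ' →
      SeqInstance (TreeTerm.bracket ζ Γ :: Δ) (ofTerm (ofStoup σ * Θ).bracketed * Θ')

/-- `Θ` arises from the meta-formula `Φ` by replacing each formula by an element of its
interpretation. -/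
def Instance (Φ Θ : MetaFormula V) : Prop :=
  ∃ σ Θ', StoupInstance Φ.stoup σ ∧ SeqInstance Φ.seq Θ' ∧ Θ = ofStoup σ * Θ'

theorem SeqInstance.append {Γ Δ : List (TreeTerm V)} {Θ Θ' : MetaFormula V}
    (h : SeqInstance Γ Θ) (h' : SeqInstance Δ Θ') : SeqInstance (Γ ++ Δ) (Θ * Θ') := by
  induction h with
  | nil => simpa using h'
  | formula A Γ Θ₁ Θ₂ hA _ ih => rw [mul_assoc]; exact .formula _ _ _ _ hA ih
  | bracket ζ σ Γ Δ Θ₁ Θ₂ hζ hΓ _ _ ih => rw [mul_assoc]; exact .bracket _ _ _ _ _ _ hζ hΓ ih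

theorem SeqInstance.of_append {Γ Δ : List (TreeTerm V)} {Θ : MetaFormula V}
    (h : SeqInstance (Γ ++ Δ) Θ) :
    ∃ Θ₁ Θ₂, SeqInstance Γ Θ₁ ∧ SeqInstance Δ Θ₂ ∧ Θ = Θ₁ * Θ₂ := by
  induction Γ generalizing Θ with
  | nil => exact ⟨1, Θ, .nil, h, by simp⟩
  | cons t Γ ih =>
    cases h with
    | formula A _ Θ₁ Θ' hA h =>
      obtain ⟨Θ₂, Θ₃, h₂, h₃, rfl⟩ := ih h
      exact ⟨_, _, .formula _ _ _ _ hA h₂, h₃, (mul_assoc _ _ _).symm⟩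
    | bracket ζ σ Γ' _ Θ₁ Θ' hζ hΓ h =>
      obtain ⟨Θ₂, Θ₃, h₂, h₃, rfl⟩ := ih h
      exact ⟨_, _, .bracket _ _ _ _ _ _ hζ hΓ h₂, h₃, (mul_assoc _ _ _).symm⟩

theorem instance_one : Instance (1 : MetaFormula V) 1 :=
  ⟨0, 1, stoupInstance_zero, .nil, rfl⟩

theorem instance_ofStoup {ζ σ : Stoup V} (h : StoupInstance ζ σ) :
    Instance (ofStoup ζ) (ofStoup σ) :=
  ⟨σ, 1, h, .nil, by simp⟩

theorem instance_formula {A : Formula V} {Θ : MetaFormula V} (h : Θ ∈ interp A) :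
    Instance (ofTerm A) Θ :=
  ⟨0, Θ * 1, stoupInstance_zero, .formula _ _ _ _ h .nil, by simp [ofStoup, ← one_def]⟩

theorem instance_bracketed {Φ Θ : MetaFormula V} (h : Instance Φ Θ) :
    Instance (ofTerm Φ.bracketed) (ofTerm Θ.bracketed) := by
  obtain ⟨σ, Θ', hσ, h, rfl⟩ := h
  exact ⟨0, _, stoupInstance_zero, .bracket _ _ _ _ _ _ hσ h .nil, by simp [ofStoup, ← one_def]⟩

theorem Instance.mul {Φ Φ' Θ Θ' : MetaFormula V} (h : Instance Φ Θ) (h' : Instance Φ' Θ') :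
    Instance (Φ * Φ') (Θ * Θ') := by
  obtain ⟨σ, Θ, hσ, h, rfl⟩ := h
  obtain ⟨σ', Θ', hσ', h', rfl⟩ := h'
  refine ⟨_, _, hσ.add hσ', h.append h', ?_⟩
  rw [ofStoup_add, mul_assoc, mul_assoc, ofStoup_mul_left_comm σ']

theorem Instance.of_one {Θ : MetaFormula V} (h : Instance 1 Θ) : Θ = 1 := by
  obtain ⟨σ, Θ', hσ, h, rfl⟩ := h
  cases h
  rw [stoupInstance_zero_iff.1 hσ]
  rfl

theorem Instance.of_ofStoup {ζ : Stoup V} {Θ : MetaFormula V} (h : Instance (ofStoup ζ) Θ) :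
    ∃ σ, StoupInstance ζ σ ∧ Θ = ofStoup σ := by
  obtain ⟨σ, Θ', hσ, h, rfl⟩ := h
  cases h
  exact ⟨σ, hσ, by simp⟩

theorem Instance.of_formula {A : Formula V} {Θ : MetaFormula V} (h : Instance (ofTerm A) Θ) :
    Θ ∈ interp A := by
  obtain ⟨σ, Θ', hσ, h, rfl⟩ := h
  rw [stoupInstance_zero_iff.1 hσ]
  cases h with
  | formula _ _ Θ Θ' hA h =>
    cases h
    simpa [ofStoup, ← one_def] using hA

theorem Instance.of_bracketed {Φ Θ : MetaFormula V} (h : Instance (ofTerm Φ.bracketed) Θ) :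
    ∃ Θ', Instance Φ Θ' ∧ Θ = ofTerm Θ'.bracketed := by
  obtain ⟨σ, Θ', hσ, h, rfl⟩ := h
  rw [stoupInstance_zero_iff.1 hσ]
  cases h with
  | bracket _ σ _ _ Θ Θ' hζ hΓ h =>
    cases h
    exact ⟨_, ⟨σ, Θ, hζ, hΓ, rfl⟩, by simp [ofStoup, ← one_def]⟩

theorem Instance.of_mul {Φ Φ' Θ : MetaFormula V} (h : Instance (Φ * Φ') Θ) :
    ∃ Θ₁ Θ₂, Instance Φ Θ₁ ∧ Instance Φ' Θ₂ ∧ Θ = Θ₁ * Θ₂ := by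
  obtain ⟨σ, Θ', hσ, h, rfl⟩ := h
  obtain ⟨σ₁, σ₂, h₁, h₂, rfl⟩ := hσ.of_add
  obtain ⟨Θ₁, Θ₂, h₃, h₄, rfl⟩ := h.of_append
  refine ⟨_, _, ⟨σ₁, Θ₁, h₁, h₃, rfl⟩, ⟨σ₂, Θ₂, h₂, h₄, rfl⟩, ?_⟩
  rw [ofStoup_add, mul_assoc, mul_assoc, ofStoup_mul_left_comm σ₂]

theorem instance_self (Φ : MetaFormula V) : Instance Φ Φ := by
  suffices h : ∀ Γ : List (TreeTerm V), SeqInstance Γ ⟨0, Γ⟩ from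
    ⟨_, _, stoupInstance_self _, h _, by simp [ofStoup, MetaFormula.mul_def]⟩
  intro Γ
  -- Tree terms and their sequences are nested, so the mutual recursor is used, with a parallel
  -- claim for single terms.
  induction Γ using TreeTerm.rec_1
    (motive_1 := fun t => SeqInstance [t] (ofTerm t)) with
  | formula A =>
    simpa using SeqInstance.formula A [] _ _ (mem_interp_and_derivable A).1 .nil
  | bracket ζ Γ ih =>
    simpa [ofStoup, MetaFormula.mul_def, bracketed, one_def] using
      SeqInstance.bracket ζ ζ Γ [] _ _ (stoupInstance_self ζ) ih .nil
  | nil => exact .nil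
  | cons t Γ ht ih => exact ht.append ih

/-- An instance of `Ξ(Φ₁, Φ, Φ₂)` consists of an instance of the context `Ξ(Φ₁, , Φ₂)` and an
instance of `Φ`. -/
theorem Instance.of_fill {Ξ : MetaContext V} {Φ₁ Φ Φ₂ X : MetaFormula V}
    (h : Instance (Ξ.fill (Φ₁ * Φ * Φ₂)) X) :
    ∃ f Θ, IsContext f ∧ Instance Φ Θ ∧ X = f Θ ∧
      ∀ Φ' Θ', Instance Φ' Θ' → Instance (Ξ.fill (Φ₁ * Φ' * Φ₂)) (f Θ') := by
  induction Ξ generalizing X with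
  | hole =>
    obtain ⟨Θ', Θ₂, h', h₂, rfl⟩ := Instance.of_mul h
    obtain ⟨Θ₁, Θ, h₁, hΘ, rfl⟩ := h'.of_mul
    exact ⟨_, Θ, isContext_mul Θ₁ Θ₂, hΘ, rfl, fun Φ' Θ' h' => (h₁.mul h').mul h₂⟩
  | inBracket σ Δ₁ Ξ Δ₂ ih =>
    have key (Ψ : MetaFormula V) : (MetaContext.inBracket σ Δ₁ Ξ Δ₂).fill Ψ =
        ⟨σ, Δ₁⟩ * ofTerm (Ξ.fill Ψ).bracketed * ⟨0, Δ₂⟩ := by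
      simp [MetaContext.fill, MetaFormula.mul_def, ofTerm]
    rw [key] at h
    obtain ⟨Θ', Θ₂, h', h₂, rfl⟩ := h.of_mul
    obtain ⟨Θ₁, Θ, h₁, hΘ, rfl⟩ := h'.of_mul
    obtain ⟨Θ, hΘ', rfl⟩ := hΘ.of_bracketed
    obtain ⟨f, Θ₀, hf, h₀, rfl, hfill⟩ := ih hΘ'
    refine ⟨_, Θ₀, (isContext_mul Θ₁ Θ₂).comp (isContext_bracket.comp hf), h₀, rfl, ?_⟩
    intro Φ' Θ' h'
    rw [key]
    exact (h₁.mul (instance_bracketed (hfill _ _ h'))).mul h₂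

/-! ### Soundness and cut -/

theorem Derivable.instance_mem_interp {Φ : MetaFormula V} {C : Formula V} (h : Derivable Φ C) :
    ∀ X, Instance Φ X → X ∈ interp C := by
  -- These identities isolate the active part as a middle factor. Stoups commute, so the passive
  -- stoup can all go to the right factor.
  have split (ζ η : Stoup V) (Δ₁ Γ Δ₂ : List (TreeTerm V)) :
      (⟨η + ζ, Δ₁ ++ Γ ++ Δ₂⟩ : MetaFormula V) = ⟨0, Δ₁⟩ * ⟨η, Γ⟩ * ⟨ζ, Δ₂⟩ := by
    simp [MetaFormula.mul_def]
  have split₀ (ζ : Stoup V) (Δ₁ Γ Δ₂ : List (TreeTerm V)) :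
      (⟨ζ, Δ₁ ++ Γ ++ Δ₂⟩ : MetaFormula V) = ⟨0, Δ₁⟩ * ⟨0, Γ⟩ * ⟨ζ, Δ₂⟩ := by
    simp [MetaFormula.mul_def]
  have split₁ (ζ η : Stoup V) (Δ₁ Δ₂ : List (TreeTerm V)) :
      (⟨ζ + η, Δ₁ ++ Δ₂⟩ : MetaFormula V) = ⟨0, Δ₁⟩ * ofStoup η * ⟨ζ, Δ₂⟩ := by
    simp [MetaFormula.mul_def, ofStoup, add_comm]
  have split₂ (ζ : Stoup V) (Δ₁ Δ₂ : List (TreeTerm V)) :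
      (⟨ζ, Δ₁ ++ Δ₂⟩ : MetaFormula V) = ⟨0, Δ₁⟩ * 1 * ⟨ζ, Δ₂⟩ := by
    simp [MetaFormula.mul_def]
  induction h with
  | id A => exact fun X h => h.of_formula
  | rdivL Ξ ζ₁ ζ₂ Δ₁ Γ Δ₂ B C D _ _ ih₁ ih₂ =>
    intro X hX
    rw [List.append_assoc Δ₁, split] at hX
    obtain ⟨f, Θ, hf, hΘ, rfl, hfill⟩ := hX.of_fill
    have e : (⟨ζ₁, [(Formula.rdiv C B : TreeTerm V)] ++ Γ⟩ : MetaFormula V) =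
        ofTerm (Formula.rdiv C B) * ⟨ζ₁, Γ⟩ := by simp [MetaFormula.mul_def, ofTerm]
    rw [e] at hΘ
    obtain ⟨Θ₁, Θ₂, h₁, h₂, rfl⟩ := hΘ.of_mul
    refine ih₂ _ ?_
    rw [split₀]
    exact hfill _ _ (instance_formula (h₁.of_formula _ (ih₁ _ h₂)))
  | rdivR ζ Γ B C _ ih =>
    intro X hX Θ hΘ
    refine ih _ ?_
    simpa [MetaFormula.mul_def, ofTerm] using hX.mul (instance_formula hΘ)
  | ldivL Ξ ζ₁ ζ₂ Δ₁ Γ Δ₂ A C D _ _ ih₁ ih₂ =>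
    intro X hX
    rw [List.append_assoc Δ₁, split] at hX
    obtain ⟨f, Θ, hf, hΘ, rfl, hfill⟩ := hX.of_fill
    have e : (⟨ζ₁, Γ ++ [(Formula.ldiv A C : TreeTerm V)]⟩ : MetaFormula V) =
        ⟨ζ₁, Γ⟩ * ofTerm (Formula.ldiv A C) := by simp [MetaFormula.mul_def, ofTerm]
    rw [e] at hΘ
    obtain ⟨Θ₁, Θ₂, h₁, h₂, rfl⟩ := hΘ.of_mul
    refine ih₂ _ ?_
    rw [split₀]
    exact hfill _ _ (instance_formula (h₂.of_formula _ (ih₁ _ h₁)))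
  | ldivR ζ Γ A C _ ih =>
    intro X hX Θ hΘ
    refine ih _ ?_
    simpa [MetaFormula.mul_def, ofTerm] using (instance_formula hΘ).mul hX
  | prodL Ξ ζ Δ₁ Δ₂ A B D _ ih =>
    intro X hX
    rw [split₀] at hX
    obtain ⟨f, Θ, hf, hΘ, rfl, hfill⟩ := hX.of_fill
    -- As `interp D` is closed and `f` is a context, it suffices to treat generators of the closure
    -- interpreting `A · B`. The left rules for `1`, `∨`, `⟨⟩`, `!` go the same way.
    refine (isDerivClosed_interp D).map_mem hf ?_ hΘ.of_formula
    rintro _ ⟨Θ₁, h₁, Θ₂, h₂, rfl⟩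
    refine ih _ ?_
    rw [split₀]
    exact hfill _ _ ((instance_formula h₁).mul (instance_formula h₂))
  | prodR ζ₁ ζ₂ Δ Γ A B _ _ ih₁ ih₂ =>
    intro X hX
    obtain ⟨Θ₁, Θ₂, h₁, h₂, rfl⟩ := Instance.of_mul (Φ := ⟨ζ₁, Δ⟩) (Φ' := ⟨ζ₂, Γ⟩) hX
    exact subset_derivClosure _ ⟨_, ih₁ _ h₁, _, ih₂ _ h₂, rfl⟩
  | oneL Ξ ζ Δ₁ Δ₂ A _ ih =>
    intro X hX
    rw [split₀] at hX
    obtain ⟨f, Θ, hf, hΘ, rfl, hfill⟩ := hX.of_fill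
    refine (isDerivClosed_interp A).map_mem hf ?_ hΘ.of_formula
    rintro _ rfl
    refine ih _ ?_
    rw [split₂]
    exact hfill _ _ instance_one
  | oneR =>
    intro X hX
    exact subset_derivClosure _ hX.of_one
  | orL Ξ ζ Δ₁ Δ₂ A₁ A₂ C _ _ ih₁ ih₂ =>
    intro X hX
    rw [split₀] at hX
    obtain ⟨f, Θ, hf, hΘ, rfl, hfill⟩ := hX.of_fill
    refine (isDerivClosed_interp C).map_mem hf ?_ hΘ.of_formula
    rintro Θ' (h | h)
    · refine ih₁ _ ?_
      rw [split₀]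
      exact hfill _ _ (instance_formula h)
    · refine ih₂ _ ?_
      rw [split₀]
      exact hfill _ _ (instance_formula h)
  | orR₁ Ξ A₁ A₂ _ ih => exact fun X hX => subset_derivClosure _ (Or.inl (ih X hX))
  | orR₂ Ξ A₁ A₂ _ ih => exact fun X hX => subset_derivClosure _ (Or.inr (ih X hX))
  | andL₁ Ξ ζ Δ₁ Δ₂ A₁ A₂ C _ ih =>
    intro X hX
    rw [split₀] at hX
    obtain ⟨f, Θ, hf, hΘ, rfl, hfill⟩ := hX.of_fill
    refine ih _ ?_
    rw [split₀]
    exact hfill _ _ (instance_formula hΘ.of_formula.1)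
  | andL₂ Ξ ζ Δ₁ Δ₂ A₁ A₂ C _ ih =>
    intro X hX
    rw [split₀] at hX
    obtain ⟨f, Θ, hf, hΘ, rfl, hfill⟩ := hX.of_fill
    refine ih _ ?_
    rw [split₀]
    exact hfill _ _ (instance_formula hΘ.of_formula.2)
  | andR Ξ A₁ A₂ _ _ ih₁ ih₂ => exact fun X hX => ⟨ih₁ X hX, ih₂ X hX⟩
  | boxL Ξ ζ Δ₁ Δ₂ A B _ ih =>
    intro X hX
    rw [split₀] at hX
    obtain ⟨f, Θ, hf, hΘ, rfl, hfill⟩ := hX.of_fill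
    obtain ⟨Θ', h', rfl⟩ := Instance.of_bracketed (Φ := ⟨0, [(Formula.box A : TreeTerm V)]⟩) hΘ
    refine ih _ ?_
    rw [split₀]
    exact hfill _ _ (instance_formula h'.of_formula)
  | boxR Ξ A _ ih => exact fun X hX => ih _ (instance_bracketed hX)
  | diaL Ξ ζ Δ₁ Δ₂ A B _ ih =>
    intro X hX
    rw [split₀] at hX
    obtain ⟨f, Θ, hf, hΘ, rfl, hfill⟩ := hX.of_fill
    refine (isDerivClosed_interp B).map_mem hf ?_ hΘ.of_formula
    rintro _ ⟨Θ', h', rfl⟩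
    refine ih _ ?_
    rw [split₀]
    exact hfill _ _ (instance_bracketed (instance_formula h'))
  | diaR Ξ A _ ih =>
    intro X hX
    obtain ⟨Θ', h', rfl⟩ := Instance.of_bracketed hX
    exact subset_derivClosure _ ⟨Θ', ih _ h', rfl⟩
  | bangL Ξ ζ Γ₁ Γ₂ A B _ ih =>
    intro X hX
    rw [split₀] at hX
    obtain ⟨f, Θ, hf, hΘ, rfl, hfill⟩ := hX.of_fill
    refine (isDerivClosed_interp B).map_mem hf ?_ hΘ.of_formula
    rintro _ ⟨ξ, hξ, h, rfl⟩
    refine ih _ ?_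
    rw [split₁]
    exact hfill _ _ (instance_ofStoup (stoupInstance_singleton hξ h))
  | bangP Ξ ζ Γ₁ Γ₂ A B _ ih =>
    intro X hX
    rw [split₁] at hX
    obtain ⟨f, Θ, hf, hΘ, rfl, hfill⟩ := hX.of_fill
    obtain ⟨σ, hσ, rfl⟩ := hΘ.of_ofStoup
    refine ih _ ?_
    rw [split₀]
    exact hfill _ _ (instance_formula hσ.of_singleton)
  | bangR ζ B hζ _ ih =>
    intro X hX
    obtain ⟨σ, hσ, rfl⟩ := Instance.of_ofStoup hX
    exact subset_derivClosure _ ⟨σ, hσ.ne_zero hζ, ih _ hX, rfl⟩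
  | bangC Ξ ζ₁ ζ₂ ζ' Γ₁ Γ₂ Γ₃ C hζ _ ih =>
    intro X hX
    have e₁ : (⟨ζ₁ + ζ₂ + ζ', Γ₁ ++ Γ₂ ++ Γ₃⟩ : MetaFormula V) =
        ⟨0, Γ₁⟩ * (ofStoup ζ₂ * ⟨ζ', Γ₂⟩) * ⟨ζ₁, Γ₃⟩ := by
      simp [MetaFormula.mul_def, ofStoup, add_comm, add_left_comm]
    have e₂ : (⟨ζ₁ + ζ₂, Γ₁ ++ [TreeTerm.bracket (ζ' + ζ₂) Γ₂] ++ Γ₃⟩ : MetaFormula V) =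
        ⟨0, Γ₁⟩ * (ofStoup ζ₂ * ofTerm (ofStoup ζ₂ * ⟨ζ', Γ₂⟩).bracketed) * ⟨ζ₁, Γ₃⟩ := by
      simp [MetaFormula.mul_def, ofStoup, ofTerm, bracketed, add_comm]
    rw [e₁] at hX
    obtain ⟨f, Θ, hf, hΘ, rfl, hfill⟩ := hX.of_fill
    obtain ⟨Θ₁, Θ₂, h₁, h₂, rfl⟩ := hΘ.of_mul
    obtain ⟨σ, hσ, rfl⟩ := h₁.of_ofStoup
    -- Both copies of `ζ₂` in the premise are instantiated by the same `σ`, so `!C'` itself can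
    -- contract them.
    refine (isDerivClosed_interp C).mem_of_replaces hf
      (replaces_contraction (hσ.ne_zero hζ) Θ₂) (ih _ ?_)
    rw [e₂]
    exact hfill _ _ (h₁.mul (instance_bracketed (h₁.mul h₂)))

end Morrill

open Morrill in
theorem mainTheorem2 {V : Type*} (Ξ : Morrill.MetaContext V) (ξ ζ : Morrill.Stoup V)
    (Φ Γ₁ Γ₂ : List (Morrill.TreeTerm V)) (A C : Morrill.Formula V)
    (hleft : Morrill.Derivable ⟨ξ, Φ⟩ A)
    (hright : Morrill.Derivable
      (Ξ.fill ⟨ζ, Γ₁ ++ [(A : Morrill.TreeTerm V)] ++ Γ₂⟩) C) :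
    Morrill.Derivable (Ξ.fill ⟨ξ + ζ, Γ₁ ++ Φ ++ Γ₂⟩) C := by
  have e₁ : (⟨ξ + ζ, Γ₁ ++ Φ ++ Γ₂⟩ : MetaFormula V) = ⟨0, Γ₁⟩ * ⟨ξ, Φ⟩ * ⟨ζ, Γ₂⟩ := by
    simp [MetaFormula.mul_def]
  have e₂ : (⟨ζ, Γ₁ ++ [(A : TreeTerm V)] ++ Γ₂⟩ : MetaFormula V) =
      ⟨0, Γ₁⟩ * MetaFormula.ofTerm A * ⟨ζ, Γ₂⟩ := by
    simp [MetaFormula.mul_def, MetaFormula.ofTerm]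
  refine (mem_interp_and_derivable C).2 _ (hright.instance_mem_interp _ ?_)
  -- Splitting the conclusion's antecedent, as an instance of itself, frees the place of `ξ; Φ`; the
  -- part `Θ` there is in `interp A` and so may be read as an instance of `A`.
  obtain ⟨f, Θ, -, hΘ, hX, hfill⟩ := (e₁ ▸ instance_self (Ξ.fill ⟨ξ + ζ, Γ₁ ++ Φ ++ Γ₂⟩) :
    Instance (Ξ.fill (⟨0, Γ₁⟩ * ⟨ξ, Φ⟩ * ⟨ζ, Γ₂⟩)) _).of_fill
  rw [e₁, hX, e₂]
  exact hfill _ _ (instance_formula (hleft.instance_mem_interp _ hΘ))
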